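/- Let $q>0$, let $a:[0,\infty)\to[0,\infty)$ be continuous and let $r:[0,\infty)\to[0,q]$ satisfy $\sup_{t\ge 0} r(t)=q$. Consider the delay equation $$x'(t)=-a(t)\,x(t-r(t)),\qquad(1)$$ where $'$ is the right-hand derivative. For $s\ge 0$ and $\varphi\in C([-q,0],\mathbb R)$ (with the sup norm $\|\cdot\|_q$), a solution with initial value $\varphi$ at $s$ is a continuous function $x$ on $[s-q,\infty)$ with $x(s+\theta)=\varphi(\theta)$ for $-q\le\theta\le 0$ that satisfies (1) for all $t\ge s$. Write $x(\varphi)$ for the solution with initial value $\varphi$ at $s=0$. For $h\in(0,q]$ put $[t]_h=\lfloor t/h\rfloor h$, and let $z_h(\varphi)$ be the solution of $$z'(t)=-a(t)\,z\bigl(\bigl[t-[r([t]_h)]_h\bigr]_h\bigr),\qquad z(nh)=\varphi(nh)\ \text{ for all integers } n \text{ with } -q\le nh\le 0,$$ that is, a function, defined at these grid points and on $[0,\infty)$, continuous on $[0,\infty)$, differentiable there except possibly at the points $jh$, $j=0,1,2,\dots$, where finite one-sided derivatives exist, and satisfying the equation on each interval $[jh,(j+1)h)$ (with the right-hand derivative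 at $jh$). Assume that * (A1) the zero solution of (1) is uniformly asymptotically stable: for each $\varepsilon>0$ there is $\delta>0$ such that $\|\varphi\|_q<\delta$ implies $|x(t)|<\varepsilon$ for all $t\ge s$, and there is $b>0$ such that for each $\varepsilon>0$ there is $T>0$ such that $\|\varphi\|_q<b$ implies $|x(t)|<\varepsilon$ for all $t\ge s+T$, in both cases for every $s\ge0$ and every solution $x$ with initial value $\varphi$ at $s$; * (A2) $a_0:=\sup_{t\ge0}|a(t)|<\infty$; * (A3) $r$ is uniformly continuous on $[0,\infty)$. Let $w_r(\ell)=\sup\{|r(t_2)-r(t_1)|: t_1,t_2\ge0,\ |t_2-t_1|\le\ell\}$ and $t_0=3q+w_r(q)$. Then there are constants $K,\sigma,M_1,\eta>0$ and $h_0\in(0,q]$, depending only on $a$ and $r$, such that every solution of (1) with initial value $\phi$ at a time $s\ge0$ satisfies $|x(t)|\le K\|\phi\|_q e^{-\sigma(t-s)}$ for $t\ge s$, and such that, for every $h\in(0,h_0]$ and every $\varphi\in C([-q,0],\mathbb R)$, $$|x(\varphi)(t)-z_h(\varphi)(t)|\le\Bigl[K\,\|E_{h,t_0}\|_q+K_1(h)\,M_1\,\|\varphi\|_q\,t\Bigr]e^{-\eta(t-t_0)},\qquad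 t\ge t_0,$$ where $\|E_{h,t_0}\|_q=\sup_{t_0-q\le s\le t_0}|x(\varphi)(s)-z_h(\varphi)(s)|$ and $K_1(h)=a_0^2\,[2h+w_r(h)]\,K$. Moreover $K_1(h)\to0$ as $h\to0^+$. -/

import Mathlib

open Set Filter Topology

noncomputable section

namespace DelayEq

/-- `x` is a solution on `[s - q, ∞)` of `x'(t) = -a(t) x(t - r(t))`, where `'` is the right-hand
derivative, with initial value `φ ∈ C([-q, 0], ℝ)` at time `s`. Only the values of `x` on
`[s - q, ∞)` matter. -/
structure IsSolution (a r : ℝ → ℝ) (q s : ℝ) (φ : C(Icc (-q) 0, ℝ)) (x : ℝ → ℝ) : Prop where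
  continuousOn : ContinuousOn x (Ici (s - q))
  initial : ∀ θ : Icc (-q) 0, x (s + θ) = φ θ
  equation : ∀ t, s ≤ t → HasDerivWithinAt x (-a t * x (t - r t)) (Ici t) t

/-- The zero solution of `x'(t) = -a(t) x(t - r(t))` is uniformly stable. -/
def UniformlyStable (a r : ℝ → ℝ) (q : ℝ) : Prop :=
  ∀ ε > 0, ∃ δ > 0, ∀ s, 0 ≤ s → ∀ (φ : C(Icc (-q) 0, ℝ)) (x : ℝ → ℝ),
    IsSolution a r q s φ x → ‖φ‖ < δ → ∀ t, s ≤ t → |x t| < ε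

/-- The zero solution of `x'(t) = -a(t) x(t - r(t))` is uniformly asymptotically stable: it is
uniformly stable, and attracts a fixed ball of initial functions, uniformly with respect to the
initial function and the initial time. -/
def UniformlyAsymptoticallyStable (a r : ℝ → ℝ) (q : ℝ) : Prop :=
  UniformlyStable a r q ∧
    ∃ b > 0, ∀ ε > 0, ∃ T > 0, ∀ s, 0 ≤ s → ∀ (φ : C(Icc (-q) 0, ℝ)) (x : ℝ → ℝ),
      IsSolution a r q s φ x → ‖φ‖ < b → ∀ t, s + T ≤ t → |x t| < ε

/-- All solutions satisfy `|x(t)| ≤ K ‖φ‖ e^{-σ (t - s)}` for `t ≥ s`, where `φ` is the initial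
value at the initial time `s ≥ 0`. -/
def ExponentialEstimate (a r : ℝ → ℝ) (q K σ : ℝ) : Prop :=
  ∀ s, 0 ≤ s → ∀ (φ : C(Icc (-q) 0, ℝ)) (x : ℝ → ℝ), IsSolution a r q s φ x →
    ∀ t, s ≤ t → |x t| ≤ K * ‖φ‖ * Real.exp (-σ * (t - s))

/-- `[t]_h = [t / h] h`. -/
def gridFloor (h t : ℝ) : ℝ := (⌊t / h⌋ : ℝ) * h

/-- The piecewise constant argument `[t - [r([t]_h)]_h]_h`. -/
def gridArg (r : ℝ → ℝ) (h t : ℝ) : ℝ :=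
  gridFloor h (t - gridFloor h (r (gridFloor h t)))

/-- `z` is a solution of `z'(t) = -a(t) z([t - [r([t]_h)]_h]_h)`, with `z(nh) = φ(nh)` at the grid
points `nh` of `[-q, 0]`: it is continuous on `[0, ∞)`, its derivative exists except possibly at
the grid points, where it has finite one-sided derivatives, and it satisfies the equation on every
interval `[jh, (j + 1)h)` (with the right-hand derivative at `jh`). Only the values of `z` on
`[0, ∞)` and at the grid points of `[-q, 0]` matter. -/
structure IsPiecewiseSolution (a r : ℝ → ℝ) (q h : ℝ) (φ : C(Icc (-q) 0, ℝ)) (z : ℝ → ℝ) :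
    Prop where
  initial : ∀ (n : ℤ) (hn : (n : ℝ) * h ∈ Icc (-q) 0), z (n * h) = φ ⟨n * h, hn⟩
  continuousOn : ContinuousOn z (Ici 0)
  equation : ∀ (j : ℕ) (t : ℝ), t ∈ Ioo (j * h) ((j + 1) * h) →
    HasDerivAt z (-a t * z (gridArg r h t)) t
  equation_right : ∀ j : ℕ,
    HasDerivWithinAt z (-a (j * h) * z (gridArg r h (j * h))) (Ici (j * h)) (j * h)
  derivative_left : ∀ j : ℕ, 0 < j → ∃ d : ℝ, HasDerivWithinAt z d (Iic (j * h)) (j * h)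

/-- `w_r(ℓ) = sup {|r(t₂) - r(t₁)| : t₁, t₂ ≥ 0, |t₂ - t₁| ≤ ℓ}`. -/
def modulus (r : ℝ → ℝ) (l : ℝ) : ℝ :=
  sSup {y | ∃ t₁ t₂ : ℝ, 0 ≤ t₁ ∧ 0 ≤ t₂ ∧ |t₂ - t₁| ≤ l ∧ y = |r t₂ - r t₁|}

/-- `a₀ = sup {|a(t)| : t ≥ 0}`. -/
def supAbs (a : ℝ → ℝ) : ℝ := sSup ((fun t => |a t|) '' Ici 0)

/-- `‖f_t‖_q = sup {|f(t + θ)| : -q ≤ θ ≤ 0}`. -/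
def segmentNorm (q : ℝ) (f : ℝ → ℝ) (t : ℝ) : ℝ :=
  sSup ((fun θ => |f (t + θ)|) '' Icc (-q) 0)

/-- `K₁(h) = a₀² (2h + w_r(h)) K`. -/
def errorCoeff (a r : ℝ → ℝ) (K h : ℝ) : ℝ :=
  supAbs a ^ 2 * (2 * h + modulus r h) * K

/-- `t₀ = 3q + w_r(q)`. -/
def startTime (r : ℝ → ℝ) (q : ℝ) : ℝ := 3 * q + modulus r q

end DelayEq

end

/-!
By linearity, (A1) upgrades to an exponential estimate. Exponential stability survives a forcing
term that is bounded by a small multiple of the solution's own history plus an exponentially small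
term: over one time scale `T` the value of the solution contracts relative to its history, and the
decay rate is read off at the maximum of `|y(t)| e^{ηt}`.

The function `z_h` solves the delay equation (1) with forcing
`-a(t) (z_h([t - [r([t]_h)]_h]_h) - z_h(t - r(t)))`. Since `|z_h'|` is bounded by `a₀` times the
history and the two arguments differ by at most `2h + w_r(h)`, this forcing is at most
`a₀² (2h + w_r(h))` times the history, so `z_h` decays at a rate `η` that does not depend on `h`.
The error `x - z_h` therefore solves (1) with a forcing of size `a₀² (2h + w_r(h)) ‖φ‖ e^{-ηt}`, and
a second application of the stability result bounds it.
-/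

namespace DelayEq

section ExponentialEnvelope

variable {E : Type*} [NormedAddCommGroup E] [NormedSpace ℝ E]

theorem exists_forall_le_mul_exp {v : ℝ → ℝ} {c b : ℝ} (hcb : c ≤ b)
    (hv : ContinuousOn v (Icc c b)) (l : ℝ) :
    ∃ m ∈ Icc c b, ∀ t ∈ Icc c b, v t ≤ v m * Real.exp (l * (t - m)) := by
  obtain ⟨m, hm, hmax⟩ := isCompact_Icc.exists_isMaxOn (nonempty_Icc.2 hcb)
    (f := fun t => v t * Real.exp (-(l * t))) (hv.mul (by fun_prop))
  refine ⟨m, hm, fun t ht => ?_⟩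
  calc v t = v t * Real.exp (-(l * t)) * Real.exp (l * t) := by
        rw [mul_assoc, ← Real.exp_add, neg_add_cancel, Real.exp_zero, mul_one]
    _ ≤ v m * Real.exp (-(l * m)) * Real.exp (l * t) :=
        mul_le_mul_of_nonneg_right (hmax ht) (Real.exp_pos _).le
    _ = v m * Real.exp (l * (t - m)) := by
        rw [mul_assoc, ← Real.exp_add]
        ring_nf

theorem norm_le_of_norm_deriv_right_le_exp {f f' : ℝ → E} {s b l B C : ℝ} (hl : l ≠ 0)
    (hf : ContinuousOn f (Icc s b)) (hf' : ∀ t ∈ Ico s b, HasDerivWithinAt f (f' t) (Ici t) t)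
    (hs : ‖f s‖ ≤ C) (bound : ∀ t ∈ Ico s b, ‖f' t‖ ≤ B * Real.exp (l * (t - s))) :
    ∀ t ∈ Icc s b, ‖f t‖ ≤ C + B / l * (Real.exp (l * (t - s)) - 1) := by
  have hB' (t : ℝ) : HasDerivAt (fun t => C + B / l * (Real.exp (l * (t - s)) - 1))
      (B * Real.exp (l * (t - s))) t := by
    have hexp : HasDerivAt (fun t => l * (t - s)) l t := by
      simpa using ((hasDerivAt_id t).sub_const s).const_mul l
    exact (((hexp.exp.sub_const 1).const_mul (B / l)).const_add C).congr_deriv (by field_simp)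
  intro t ht
  exact image_norm_le_of_norm_deriv_right_le_deriv_boundary hf hf' (by simpa using hs) hB' bound ht

/-- The bound `N ≥ C` in the hypothesis is to be read with `C` a bound for the history before
`s`. -/
theorem norm_le_exp_of_norm_deriv_right_le_history {f f' : ℝ → E} {s b A C F : ℝ} (hA : 0 ≤ A)
    (hF : 0 ≤ F) (hf : ContinuousOn f (Icc s b))
    (hf' : ∀ t ∈ Ico s b, HasDerivWithinAt f (f' t) (Ici t) t) (hs : ‖f s‖ ≤ C)
    (bound : ∀ t ∈ Ico s b, ∀ N, C ≤ N → (∀ u ∈ Icc s t, ‖f u‖ ≤ N) → ‖f' t‖ ≤ A * N + F) :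
    ∀ t ∈ Icc s b, ‖f t‖ ≤ ((A + 1) * C + F) * Real.exp ((A + 1) * (t - s)) := by
  intro t ht
  have hC : 0 ≤ C := (norm_nonneg _).trans hs
  have hl : 0 < A + 1 := by positivity
  obtain ⟨m, hm, hmax⟩ := exists_forall_le_mul_exp (ht.1.trans ht.2) hf.norm (A + 1)
  set M : ℝ := max (‖f m‖ * Real.exp (-((A + 1) * (m - s)))) C
  have hCM : C ≤ M := le_max_right _ _
  have hfM (u : ℝ) (hu : u ∈ Icc s b) : ‖f u‖ ≤ M * Real.exp ((A + 1) * (u - s)) := by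
    calc ‖f u‖ ≤ ‖f m‖ * Real.exp ((A + 1) * (u - m)) := hmax u hu
      _ = ‖f m‖ * Real.exp (-((A + 1) * (m - s))) * Real.exp ((A + 1) * (u - s)) := by
          rw [mul_assoc, ← Real.exp_add]
          ring_nf
      _ ≤ M * Real.exp ((A + 1) * (u - s)) := by
          gcongr
          exact le_max_left _ _
  have hf'M (u : ℝ) (hu : u ∈ Ico s b) :
      ‖f' u‖ ≤ (A * M + F) * Real.exp ((A + 1) * (u - s)) := by
    have hexp : 1 ≤ Real.exp ((A + 1) * (u - s)) :=
      Real.one_le_exp (mul_nonneg hl.le (sub_nonneg.2 hu.1))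
    have := bound u hu (M * Real.exp ((A + 1) * (u - s)))
      (hCM.trans (le_mul_of_one_le_right (hC.trans hCM) hexp)) fun w hw =>
        (hfM w ⟨hw.1, hw.2.trans hu.2.le⟩).trans
          (mul_le_mul_of_nonneg_left (by have := hw.2; gcongr) (hC.trans hCM))
    linarith [le_mul_of_one_le_right hF hexp]
  have hM : M ≤ C + (A * M + F) / (A + 1) := by
    have hB : 0 ≤ (A * M + F) / (A + 1) :=
      div_nonneg (add_nonneg (mul_nonneg hA (hC.trans hCM)) hF) hl.le
    refine max_le ?_ (le_add_of_nonneg_right hB)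
    rw [Real.exp_neg, ← div_eq_mul_inv, div_le_iff₀ (Real.exp_pos _)]
    have hexp : 1 ≤ Real.exp ((A + 1) * (m - s)) :=
      Real.one_le_exp (mul_nonneg hl.le (sub_nonneg.2 hm.1))
    linarith [norm_le_of_norm_deriv_right_le_exp hl.ne' hf hf' hs hf'M m hm,
      le_mul_of_one_le_right hC hexp]
  have hM' : M ≤ (A + 1) * C + F := by
    rw [← sub_le_iff_le_add', le_div_iff₀ hl] at hM
    linarith
  exact (hfM t ht).trans (by gcongr)

theorem le_mul_exp_of_delayed_contraction {v : ℝ → ℝ} {s p T η ρ C F : ℝ} (hp : 0 ≤ p)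
    (hT : 0 ≤ T) (hη : 0 ≤ η) (hρη : ρ * Real.exp (η * (T + p)) ≤ 1 / 2)
    (hF : 0 ≤ F) (hv0 : ∀ t, 0 ≤ v t) (hv : ContinuousOn v (Ici (s - p)))
    (hinit : ∀ t ∈ Icc (s - p) (s + T), v t ≤ C)
    (hstep : ∀ t, s + T ≤ t → ∀ N, (∀ u ∈ Icc (t - T - p) (t - T), v u ≤ N) →
      v t ≤ ρ * N + F * Real.exp (-η * (t - s))) {t : ℝ} (ht : s ≤ t) :
    v t ≤ (Real.exp (η * T) * C + 2 * F) * Real.exp (-η * (t - s)) := by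
  have hC : 0 ≤ C := (hv0 s).trans (hinit s ⟨by linarith, by linarith⟩)
  obtain ⟨m, hm, hmax⟩ := exists_forall_le_mul_exp (show s - p ≤ t by linarith)
    (hv.mono fun u hu => hu.1) (-η)
  suffices hvm : v m ≤ (Real.exp (η * T) * C + 2 * F) * Real.exp (-η * (m - s)) by
    calc v t ≤ v m * Real.exp (-η * (t - m)) := hmax t ⟨by linarith, le_rfl⟩
      _ ≤ (Real.exp (η * T) * C + 2 * F) * Real.exp (-η * (m - s)) * Real.exp (-η * (t - m)) := by
          gcongr
      _ = (Real.exp (η * T) * C + 2 * F) * Real.exp (-η * (t - s)) := by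
          rw [mul_assoc, ← Real.exp_add]
          ring_nf
  rcases le_total m (s + T) with hmT | hmT
  · have hexp : 1 ≤ Real.exp (η * T) * Real.exp (-η * (m - s)) := by
      rw [← Real.exp_add]
      exact Real.one_le_exp (by nlinarith)
    have h2F : 0 ≤ 2 * F * Real.exp (-η * (m - s)) := by positivity
    linarith [hinit m ⟨hm.1, hmT⟩, le_mul_of_one_le_left hC hexp]
  · have hhist (u : ℝ) (hu : u ∈ Icc (m - T - p) (m - T)) :
        v u ≤ v m * Real.exp (η * (T + p)) := by
      refine (hmax u ⟨by linarith [hu.1], by linarith [hu.2, hm.2]⟩).trans ?_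
      refine mul_le_mul_of_nonneg_left (Real.exp_le_exp.2 ?_) (hv0 m)
      nlinarith [hu.1]
    have hhalf : ρ * (v m * Real.exp (η * (T + p))) ≤ v m / 2 := by
      linarith [mul_le_mul_of_nonneg_right hρη (hv0 m)]
    have hCexp : 0 ≤ Real.exp (η * T) * C * Real.exp (-η * (m - s)) := by positivity
    linarith [hstep m hmT _ hhist]

end ExponentialEnvelope

/-- The Bielecki weight: in the supremum norm with this weight, a Volterra operator whose kernel is
bounded by `A < l` is a contraction. It is constant before `s`. -/
noncomputable def bieleckiWeight (l s t : ℝ) : ℝ := Real.exp (l * (max t s - s))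

theorem continuous_bieleckiWeight (l s : ℝ) : Continuous (bieleckiWeight l s) := by
  unfold bieleckiWeight
  fun_prop

theorem bieleckiWeight_pos (l s t : ℝ) : 0 < bieleckiWeight l s t := Real.exp_pos _

theorem one_le_bieleckiWeight {l : ℝ} (hl : 0 ≤ l) (s t : ℝ) : 1 ≤ bieleckiWeight l s t :=
  Real.one_le_exp (mul_nonneg hl (sub_nonneg.2 (le_max_right _ _)))

theorem bieleckiWeight_le_exp {l s u t : ℝ} (hl : 0 ≤ l) (hut : u ≤ t) (hst : s ≤ t) :
    bieleckiWeight l s u ≤ Real.exp (l * (t - s)) :=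
  Real.exp_le_exp.2 (mul_le_mul_of_nonneg_left (sub_le_sub_right (max_le hut hst) s) hl)

section Volterra

open scoped BoundedContinuousFunction

variable {E : Type*} [NormedAddCommGroup E] [NormedSpace ℝ E] [CompleteSpace E]

theorem norm_integral_le_of_norm_le_exp {g : ℝ → E} {s t l B : ℝ} (hst : s ≤ t) (hl : 0 < l)
    (hB : 0 ≤ B) (hg : Continuous g) (bound : ∀ ξ, s ≤ ξ → ‖g ξ‖ ≤ B * Real.exp (l * (ξ - s))) :
    ‖∫ ξ in s..t, g ξ‖ ≤ B / l * Real.exp (l * (t - s)) := by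
  have hderiv (τ : ℝ) : HasDerivAt (fun τ => ∫ ξ in s..τ, g ξ) (g τ) τ :=
    hg.integral_hasStrictDerivAt s τ |>.hasDerivAt
  have hle := norm_le_of_norm_deriv_right_le_exp (f := fun τ => ∫ ξ in s..τ, g ξ) (b := t)
    (C := 0) hl.ne'
    (fun τ _ => (hderiv τ).continuousAt.continuousWithinAt)
    (fun τ _ => (hderiv τ).hasDerivWithinAt) (by simp) (fun τ hτ => bound τ hτ.1)
    t ⟨hst, le_rfl⟩
  have hBl : 0 ≤ B / l := by positivity
  linarith

theorem exists_volterra_operator {α d : ℝ → ℝ} {A : ℝ} (s : ℝ) (hα : Continuous α)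
    (hd : Continuous d) (hαA : ∀ t, |α t| ≤ A) (hdt : ∀ t, d t ≤ t) :
    ∃ L : (ℝ →ᵇ E) →L[ℝ] (ℝ →ᵇ E), ‖L‖ ≤ A / (A + 1) ∧ ∀ u t,
      L u t = (bieleckiWeight (A + 1) s t)⁻¹ •
        ∫ ξ in s..max t s, α ξ • bieleckiWeight (A + 1) s (d ξ) • u (d ξ) := by
  have hA : 0 ≤ A := (abs_nonneg _).trans (hαA 0)
  set w := bieleckiWeight (A + 1) s
  have hw : Continuous w := continuous_bieleckiWeight _ _
  have hwpos (t : ℝ) : 0 < w t := bieleckiWeight_pos _ _ _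
  have hint (u : ℝ →ᵇ E) : Continuous fun ξ => α ξ • w (d ξ) • u (d ξ) := by fun_prop
  have hcont (u : ℝ →ᵇ E) :
      Continuous fun t => (w t)⁻¹ • ∫ ξ in s..max t s, α ξ • w (d ξ) • u (d ξ) := by
    have hprim : Continuous fun t => ∫ ξ in s..t, α ξ • w (d ξ) • u (d ξ) :=
      intervalIntegral.continuous_primitive (fun _ _ => (hint u).intervalIntegrable _ _) s
    exact (hw.inv₀ fun t => (hwpos t).ne').smul (hprim.comp (by fun_prop : Continuous (max · s)))
  have hbound (u : ℝ →ᵇ E) (t : ℝ) :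
      ‖(w t)⁻¹ • ∫ ξ in s..max t s, α ξ • w (d ξ) • u (d ξ)‖ ≤ A / (A + 1) * ‖u‖ := by
    have hle := norm_integral_le_of_norm_le_exp (l := A + 1) (B := A * ‖u‖) (le_max_right t s)
      (by positivity) (by positivity) (hint u) fun ξ hξ => by
        rw [norm_smul, norm_smul, Real.norm_eq_abs, Real.norm_of_nonneg (hwpos _).le]
        calc |α ξ| * (w (d ξ) * ‖u (d ξ)‖)
            ≤ A * (Real.exp ((A + 1) * (ξ - s)) * ‖u‖) := by
              have hwexp : w (d ξ) ≤ Real.exp ((A + 1) * (ξ - s)) :=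
                bieleckiWeight_le_exp (by positivity) (hdt ξ) hξ
              have hw0 := hwpos (d ξ)
              gcongr
              exacts [hαA ξ, u.norm_coe_le_norm _]
          _ = A * ‖u‖ * Real.exp ((A + 1) * (ξ - s)) := by ring
    rw [norm_smul, norm_inv, Real.norm_of_nonneg (hwpos t).le, inv_mul_le_iff₀ (hwpos t)]
    exact hle.trans_eq (by simp only [w, bieleckiWeight]; ring)
  refine ⟨LinearMap.mkContinuous
    { toFun := fun u => .ofNormedAddCommGroup _ (hcont u) _ (hbound u)
      map_add' := fun u v => ?_
      map_smul' := fun c u => ?_ } (A / (A + 1)) fun u => ?_,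
    LinearMap.mkContinuous_norm_le _ (by positivity) _, fun u t => rfl⟩
  · ext t
    simp only [BoundedContinuousFunction.coe_ofNormedAddCommGroup,
      BoundedContinuousFunction.coe_add, Pi.add_apply, smul_add]
    rw [intervalIntegral.integral_add ((hint u).intervalIntegrable _ _)
      ((hint v).intervalIntegrable _ _), smul_add]
  · ext t
    simp only [BoundedContinuousFunction.coe_ofNormedAddCommGroup,
      BoundedContinuousFunction.coe_smul, RingHom.id_apply, smul_comm _ c]
    rw [intervalIntegral.integral_smul, smul_comm]
  · exact (BoundedContinuousFunction.norm_le (by positivity)).2 (hbound u)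

theorem exists_eq_add_integral {α d : ℝ → ℝ} {A : ℝ} (s : ℝ) (hα : Continuous α)
    (hd : Continuous d) (hαA : ∀ t, |α t| ≤ A) (hdt : ∀ t, d t ≤ t) (ψ : ℝ →ᵇ E) :
    ∃ y : ℝ → E, Continuous y ∧ ∀ t, y t = ψ t + ∫ ξ in s..max t s, α ξ • y (d ξ) := by
  have hA : 0 ≤ A := (abs_nonneg _).trans (hαA 0)
  have hw := continuous_bieleckiWeight (A + 1) s
  have hwpos := bieleckiWeight_pos (A + 1) s
  obtain ⟨L, hL, hLu⟩ := exists_volterra_operator (E := E) s hα hd hαA hdt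
  have hunit : IsUnit (1 - L) :=
    isUnit_one_sub_of_norm_lt_one (hL.trans_lt ((div_lt_one (by positivity)).2 (by linarith)))
  let ψw : ℝ →ᵇ E := .ofNormedAddCommGroup (fun t => (bieleckiWeight (A + 1) s t)⁻¹ • ψ t)
    ((hw.inv₀ fun t => (hwpos t).ne').smul ψ.continuous) ‖ψ‖ fun t => by
      rw [norm_smul, norm_inv, Real.norm_of_nonneg (hwpos t).le]
      exact (mul_le_of_le_one_left (norm_nonneg _)
        (inv_le_one_of_one_le₀ (one_le_bieleckiWeight (by positivity) s t))).trans
          (ψ.norm_coe_le_norm t)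
  obtain ⟨u, hu⟩ :=
    ((ContinuousLinearMap.isUnit_iff_bijective).1 hunit).surjective ψw
  refine ⟨fun t => bieleckiWeight (A + 1) s t • u t, hw.smul u.continuous, fun t => ?_⟩
  have hut : u t = ψw t + L u t := by
    rw [← hu]
    simp
  simp only
  rw [hut, smul_add, hLu, smul_inv_smul₀ (hwpos t).ne']
  congr 1
  exact smul_inv_smul₀ (hwpos t).ne' _

end Volterra


/-- The standing assumptions on the delay equation `x'(t) = -a(t) x(t - r(t))` for `t ≥ 0`:
continuous coefficient bounded by `A`, continuous delay with values in `[0, q]`. -/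
structure IsBoundedDelaySystem (a r : ℝ → ℝ) (q A : ℝ) : Prop where
  continuousOn_coeff : ContinuousOn a (Ici 0)
  abs_coeff_le : ∀ t, 0 ≤ t → |a t| ≤ A
  continuousOn_delay : ContinuousOn r (Ici 0)
  mapsTo_delay : MapsTo r (Ici 0) (Icc 0 q)

/-- `y` is a solution on `[s - p, ∞)` of the forced equation `y'(t) = -a(t) y(t - r(t)) + f(t)`,
`t ≥ s`, where `'` is the right-hand derivative. The history length `p` may exceed the maximal
delay. -/
structure IsForcedSolution (a r f : ℝ → ℝ) (p s : ℝ) (y : ℝ → ℝ) : Prop where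
  continuousOn : ContinuousOn y (Ici (s - p))
  equation : ∀ t, s ≤ t → HasDerivWithinAt y (-a t * y (t - r t) + f t) (Ici t) t

/-- The segment `θ ↦ x (s + θ)`, `-q ≤ θ ≤ 0`, of a function continuous on `[s - q, ∞)`. -/
def segment (q s : ℝ) (x : ℝ → ℝ) (hx : ContinuousOn x (Ici (s - q))) : C(Icc (-q) 0, ℝ) where
  toFun θ := x (s + θ)
  continuous_toFun := hx.comp_continuous (by fun_prop) fun θ => by
    have := θ.2.1
    simp only [mem_Ici]
    linarith

theorem norm_segment_le {q s : ℝ} {x : ℝ → ℝ} (hx : ContinuousOn x (Ici (s - q))) {N : ℝ}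
    (hN : 0 ≤ N) (h : ∀ t ∈ Icc (s - q) s, |x t| ≤ N) : ‖segment q s x hx‖ ≤ N :=
  (ContinuousMap.norm_le _ hN).2 fun θ =>
    h _ ⟨by linarith [θ.2.1], by linarith [θ.2.2]⟩

namespace IsBoundedDelaySystem

variable {a r : ℝ → ℝ} {q A : ℝ}

theorem bound_nonneg (S : IsBoundedDelaySystem a r q A) : 0 ≤ A :=
  (abs_nonneg _).trans (S.abs_coeff_le 0 le_rfl)

theorem maxDelay_nonneg (S : IsBoundedDelaySystem a r q A) : 0 ≤ q :=
  nonempty_Icc.1 ⟨_, S.mapsTo_delay self_mem_Ici⟩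

theorem sub_delay_mem_Icc (S : IsBoundedDelaySystem a r q A) {t : ℝ} (ht : 0 ≤ t) :
    t - r t ∈ Icc (t - q) t :=
  ⟨sub_le_sub_left (S.mapsTo_delay ht).2 t, sub_le_self t (S.mapsTo_delay ht).1⟩

theorem abs_coeff_mul_le (S : IsBoundedDelaySystem a r q A) {t : ℝ} (ht : 0 ≤ t) (v : ℝ) :
    |a t * v| ≤ A * |v| := by
  rw [abs_mul]
  exact mul_le_mul_of_nonneg_right (S.abs_coeff_le t ht) (abs_nonneg v)

theorem abs_forced_deriv_le (S : IsBoundedDelaySystem a r q A) {f y : ℝ → ℝ} {t N F : ℝ}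
    (ht : 0 ≤ t) (hN : |y (t - r t)| ≤ N) (hF : |f t| ≤ F) :
    |-a t * y (t - r t) + f t| ≤ A * N + F := by
  refine (abs_add_le _ _).trans (add_le_add ?_ hF)
  rw [neg_mul, abs_neg]
  exact (S.abs_coeff_mul_le ht _).trans (mul_le_mul_of_nonneg_left hN S.bound_nonneg)

theorem exists_isSolution (S : IsBoundedDelaySystem a r q A) {s : ℝ} (hs : 0 ≤ s)
    (φ : C(Icc (-q) 0, ℝ)) : ∃ x, IsSolution a r q s φ x := by
  have hq : -q ≤ 0 := neg_nonpos.2 S.maxDelay_nonneg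
  have hext {g : ℝ → ℝ} (hg : ContinuousOn g (Ici 0)) : Continuous fun t => g (max t 0) :=
    hg.comp_continuous (by fun_prop) fun t => mem_Ici.2 (le_max_right t 0)
  have hα : Continuous fun t => -a (max t 0) := (hext S.continuousOn_coeff).neg
  have hd : Continuous fun t => t - r (max t 0) := continuous_id.sub (hext S.continuousOn_delay)
  obtain ⟨y, hy, hyeq⟩ := exists_eq_add_integral s hα hd
    (fun t => (abs_neg _).trans_le (S.abs_coeff_le _ (le_max_right t 0)))
    (fun t => sub_le_self t (S.mapsTo_delay (le_max_right t 0)).1)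
    ((BoundedContinuousFunction.mkOfCompact φ).compContinuous
      ⟨fun t => projIcc (-q) 0 hq (t - s), by fun_prop⟩)
  refine ⟨y, hy.continuousOn, fun θ => ?_, fun t ht => ?_⟩
  · rw [hyeq, max_eq_right (by linarith [θ.2.2]), intervalIntegral.integral_same, add_zero]
    simp
  · have hderiv : HasDerivAt
        (fun τ => φ ⟨0, hq, le_rfl⟩ + ∫ ξ in s..τ, -a (max ξ 0) • y (ξ - r (max ξ 0)))
        (-a (max t 0) • y (t - r (max t 0))) t :=
      ((hα.smul (hy.comp hd)).integral_hasStrictDerivAt s t).hasDerivAt.const_add _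
    rw [max_eq_left (hs.trans ht), smul_eq_mul] at hderiv
    have hyt (u : ℝ) (hu : s ≤ u) : y u =
        φ ⟨0, hq, le_rfl⟩ + ∫ ξ in s..u, -a (max ξ 0) • y (ξ - r (max ξ 0)) := by
      rw [hyeq u, max_eq_left hu]
      simp [projIcc_of_right_le hq (sub_nonneg.2 hu)]
    exact hderiv.hasDerivWithinAt.congr (fun u hu => hyt u (ht.trans hu)) (hyt t ht)

end IsBoundedDelaySystem

section AsymptoticStability

variable {a r : ℝ → ℝ} {q s : ℝ} {φ : C(Icc (-q) 0, ℝ)} {x : ℝ → ℝ}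

theorem IsSolution.restart (h : IsSolution a r q s φ x) {s' : ℝ} (hs : s ≤ s') :
    IsSolution a r q s'
      (segment q s' x (h.continuousOn.mono (Ici_subset_Ici.2 (by linarith)))) x where
  continuousOn := h.continuousOn.mono (Ici_subset_Ici.2 (by linarith))
  initial _ := rfl
  equation t ht := h.equation t (hs.trans ht)

theorem IsSolution.const_mul (h : IsSolution a r q s φ x) (c : ℝ) :
    IsSolution a r q s (c • φ) (fun t => c * x t) where
  continuousOn := h.continuousOn.const_smul c
  initial θ := by simp [h.initial θ]
  equation t ht := ((h.equation t ht).const_mul c).congr_deriv (by ring)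

theorem IsSolution.abs_le_norm (h : IsSolution a r q s φ x) {t : ℝ} (ht : t ∈ Icc (s - q) s) :
    |x t| ≤ ‖φ‖ := by
  have hθ := h.initial ⟨t - s, by linarith [ht.1], by linarith [ht.2]⟩
  rw [add_sub_cancel] at hθ
  rw [hθ]
  exact φ.norm_coe_le_norm _

theorem IsSolution.abs_le_mul_norm_of_small {δ ε t : ℝ} (hδ : 0 < δ)
    (h : ∀ (φ : C(Icc (-q) 0, ℝ)) (x : ℝ → ℝ), IsSolution a r q s φ x → ‖φ‖ < δ → |x t| < ε)
    (hx : IsSolution a r q s φ x) : |x t| ≤ 2 * ε / δ * ‖φ‖ := by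
  rcases (norm_nonneg φ).eq_or_lt with hφ | hφ
  · rw [← hφ, mul_zero]
    by_contra! hpos
    have hlt := h _ _ (hx.const_mul (ε / |x t|)) (by rwa [norm_smul, ← hφ, mul_zero])
    rw [abs_mul, abs_div, abs_abs, div_mul_cancel₀ _ hpos.ne'] at hlt
    exact (le_abs_self ε).not_gt hlt
  · have hc : 0 < δ / (2 * ‖φ‖) := by positivity
    have hlt := h _ _ (hx.const_mul (δ / (2 * ‖φ‖))) (by
      rw [norm_smul, Real.norm_of_nonneg hc.le]
      field_simp
      linarith)
    rw [abs_mul, abs_of_pos hc] at hlt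
    calc |x t| = 2 / δ * ‖φ‖ * (δ / (2 * ‖φ‖) * |x t|) := by field_simp
      _ ≤ 2 / δ * ‖φ‖ * ε := by gcongr
      _ = 2 * ε / δ * ‖φ‖ := by ring

theorem UniformlyAsymptoticallyStable.exists_exponentialEstimate (hq : 0 < q)
    (h : UniformlyAsymptoticallyStable a r q) :
    ∃ K σ : ℝ, 0 < K ∧ 0 < σ ∧ ExponentialEstimate a r q K σ := by
  obtain ⟨hstable, b, hb, hattract⟩ := h
  obtain ⟨δ, hδ, hstable⟩ := hstable 1 one_pos
  obtain ⟨T, hT, hattract⟩ := hattract (b / 8) (by positivity)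
  have hσ : 0 < Real.log 2 / (T + q) := by positivity
  refine ⟨Real.exp (Real.log 2 / (T + q) * T) * (1 + 2 / δ), Real.log 2 / (T + q),
    by positivity, hσ, fun s hs φ x hx t ht => ?_⟩
  have hrate : 1 / 4 * Real.exp (Real.log 2 / (T + q) * (T + q)) ≤ 1 / 2 := by
    rw [div_mul_cancel₀ _ (by positivity), Real.exp_log two_pos]
    norm_num
  have hinit (u : ℝ) (hu : u ∈ Icc (s - q) (s + T)) : |x u| ≤ (1 + 2 / δ) * ‖φ‖ := by
    have h2δ : 0 ≤ 2 / δ * ‖φ‖ := by positivity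
    rcases le_total u s with hus | hus
    · linarith [hx.abs_le_norm ⟨hu.1, hus⟩]
    · have := hx.abs_le_mul_norm_of_small hδ fun φ x hx hφ => hstable s hs φ x hx hφ u hus
      rw [mul_one] at this
      linarith [norm_nonneg φ]
  have hstep (u : ℝ) (hu : s + T ≤ u) (N : ℝ)
      (hN : ∀ τ ∈ Icc (u - T - q) (u - T), |x τ| ≤ N) :
      |x u| ≤ 1 / 4 * N + 0 * Real.exp (-(Real.log 2 / (T + q)) * (u - s)) := by
    have hsu : s ≤ u - T := by linarith
    have hN0 : 0 ≤ N := (abs_nonneg _).trans (hN _ ⟨by linarith, le_rfl⟩)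
    have hle := (hx.restart hsu).abs_le_mul_norm_of_small hb fun φ x hx hφ =>
      hattract (u - T) (hs.trans hsu) φ x hx hφ u (by linarith)
    have hcoeff : 2 * (b / 8) / b = 1 / 4 := by field_simp; norm_num
    rw [hcoeff] at hle
    linarith [norm_segment_le (hx.restart hsu).continuousOn hN0 hN]
  have := le_mul_exp_of_delayed_contraction hq.le hT.le hσ.le hrate le_rfl
    (fun u => abs_nonneg (x u)) hx.continuousOn.abs hinit hstep ht
  linarith

end AsymptoticStability

section Perturbation

variable {a r f g y u : ℝ → ℝ} {q p s A K σ ε η T N F : ℝ}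

theorem IsSolution.isForcedSolution {φ : C(Icc (-q) 0, ℝ)} (h : IsSolution a r q s φ y) :
    IsForcedSolution a r 0 q s y where
  continuousOn := h.continuousOn
  equation t ht := by simpa using h.equation t ht

namespace IsForcedSolution

theorem mono {p' s' : ℝ} (hy : IsForcedSolution a r f p s y) (hs : s ≤ s')
    (hp : s - p ≤ s' - p') : IsForcedSolution a r f p' s' y where
  continuousOn := hy.continuousOn.mono (Ici_subset_Ici.2 hp)
  equation t ht := hy.equation t (hs.trans ht)

theorem sub (hy : IsForcedSolution a r f p s y) (hu : IsForcedSolution a r g p s u) :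
    IsForcedSolution a r (f - g) p s (y - u) where
  continuousOn := hy.continuousOn.sub hu.continuousOn
  equation t ht := ((hy.equation t ht).sub (hu.equation t ht)).congr_deriv (by
    simp only [Pi.sub_apply]
    ring)

theorem abs_le_of_abs_forcing_le (S : IsBoundedDelaySystem a r q A)
    (hE : ExponentialEstimate a r q K σ) (hK : 0 ≤ K) (hs : 0 ≤ s) (hF : 0 ≤ F)
    (hy : IsForcedSolution a r f q s y) (hN : ∀ t ∈ Icc (s - q) s, |y t| ≤ N) {b : ℝ}
    (hf : ∀ t ∈ Icc s b, |f t| ≤ F) {t : ℝ} (ht : t ∈ Icc s b) :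
    |y t| ≤ K * N * Real.exp (-σ * (t - s)) + F * Real.exp ((A + 1) * (t - s)) := by
  have hq := S.maxDelay_nonneg
  have hN0 : 0 ≤ N := (abs_nonneg _).trans (hN s ⟨by linarith, le_rfl⟩)
  obtain ⟨x, hx⟩ := S.exists_isSolution hs (segment q s y hy.continuousOn)
  have hD := hy.sub hx.isForcedSolution
  have hD0 (u : ℝ) (hu : u ∈ Icc (s - q) s) : (y - x) u = 0 := by
    have hθ := hx.initial ⟨u - s, by linarith [hu.1], by linarith [hu.2]⟩
    simp only [segment, ContinuousMap.coe_mk, add_sub_cancel] at hθ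
    rw [Pi.sub_apply, hθ, sub_self]
  have hDle := norm_le_exp_of_norm_deriv_right_le_history (C := 0) S.bound_nonneg hF
    (hD.continuousOn.mono fun u hu => by simp only [mem_Ici]; linarith [hu.1])
    (fun u hu => hD.equation u hu.1) (by simp [hD0 s ⟨by linarith, le_rfl⟩])
    (fun u hu B hB hDB => S.abs_forced_deriv_le (hs.trans hu.1) (by
      obtain ⟨hlow, hup⟩ := S.sub_delay_mem_Icc (hs.trans hu.1)
      rcases le_total (u - r u) s with hus | hus
      · rwa [hD0 _ ⟨by linarith [hu.1], hus⟩, abs_zero]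
      · exact hDB _ ⟨hus, hup⟩) (by simpa using hf u ⟨hu.1, hu.2.le⟩)) t ht
  rw [mul_zero, zero_add, Real.norm_eq_abs, Pi.sub_apply] at hDle
  have hxle : |x t| ≤ K * N * Real.exp (-σ * (t - s)) := by
    refine (hE s hs _ x hx t ht.1).trans ?_
    gcongr
    exact norm_segment_le _ hN0 hN
  linarith [abs_sub_abs_le_abs_sub (y t) (x t)]

end IsForcedSolution

/-- The factor by which a solution can grow in time `T`, when the coefficient is bounded by `A` and
the forcing by the history of the solution. -/
noncomputable def growthFactor (A T : ℝ) : ℝ := (A + 2) * Real.exp ((A + 2) * T)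

/-- The time scale `T` and the rate `η` at which perturbed solutions with history of length `p` are
shown to decay, given the constants `K`, `σ` of an exponential estimate. -/
structure IsDecayScale (K σ p T η : ℝ) : Prop where
  history_le : p ≤ T
  mul_exp_le : K * Real.exp (-σ * T) ≤ 1 / 8
  rate_pos : 0 < η
  exp_rate_le : Real.exp (η * (T + p)) ≤ 2

theorem IsDecayScale.mono {p' : ℝ} (D : IsDecayScale K σ p T η) (hp : p' ≤ p) :
    IsDecayScale K σ p' T η where
  history_le := hp.trans D.history_le
  mul_exp_le := D.mul_exp_le
  rate_pos := D.rate_pos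
  exp_rate_le := by
    refine le_trans (Real.exp_le_exp.2 ?_) D.exp_rate_le
    exact mul_le_mul_of_nonneg_left (by linarith) D.rate_pos.le

theorem IsDecayScale.exp_sub_le (D : IsDecayScale K σ p T η) {c : ℝ} (hc : c ≤ T + p) (t : ℝ) :
    Real.exp (-η * (t - c)) ≤ 2 * Real.exp (-η * t) := by
  rw [show -η * (t - c) = η * c + -η * t by ring, Real.exp_add]
  gcongr
  exact le_trans (Real.exp_le_exp.2 (mul_le_mul_of_nonneg_left hc D.rate_pos.le)) D.exp_rate_le

theorem exists_isDecayScale (K : ℝ) {σ p : ℝ} (hσ : 0 < σ) (hp : 0 ≤ p) :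
    ∃ T η, IsDecayScale K σ p T η := by
  have hlim : Tendsto (fun T => K * Real.exp (-σ * T)) atTop (𝓝 (K * 0)) :=
    (Real.tendsto_exp_atBot.comp
      (tendsto_id.const_mul_atTop_of_neg (neg_neg_of_pos hσ))).const_mul K
  rw [mul_zero] at hlim
  obtain ⟨T, hKT, hT⟩ := ((hlim.eventually_le_const (by norm_num : (0 : ℝ) < 1 / 8)).and
    (eventually_ge_atTop (p + 1))).exists
  have hTp : 0 < T + p := by linarith
  refine ⟨T, Real.log 2 / (T + p), by linarith, hKT, by positivity, ?_⟩
  rw [div_mul_cancel₀ _ hTp.ne', Real.exp_log two_pos]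

theorem exp_le_growthFactor (hA : 0 ≤ A) (hT : 0 ≤ T) :
    Real.exp ((A + 1) * T) ≤ growthFactor A T := by
  have hexp : Real.exp ((A + 1) * T) ≤ Real.exp ((A + 2) * T) := by
    gcongr
    norm_num
  exact hexp.trans (le_mul_of_one_le_left (Real.exp_pos _).le (by linarith))

theorem one_le_growthFactor (hA : 0 ≤ A) (hT : 0 ≤ T) : 1 ≤ growthFactor A T :=
  (Real.one_le_exp (by positivity)).trans (exp_le_growthFactor hA hT)

namespace IsForcedSolution

theorem abs_le_growthFactor_mul (S : IsBoundedDelaySystem a r q A) (hqp : q ≤ p) (hs : 0 ≤ s)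
    (hT : 0 ≤ T) (hε : ε ≤ 1) (hF : 0 ≤ F) (hy : IsForcedSolution a r f p s y)
    (hN : ∀ t ∈ Icc (s - p) s, |y t| ≤ N)
    (hf : ∀ t ∈ Icc s (s + T), ∀ N, (∀ u ∈ Icc (t - p) t, |y u| ≤ N) → |f t| ≤ ε * N + F) {t : ℝ}
    (ht : t ∈ Icc (s - p) (s + T)) : |y t| ≤ growthFactor A T * (N + F) := by
  have hp : 0 ≤ p := S.maxDelay_nonneg.trans hqp
  have hA := S.bound_nonneg
  have hN0 : 0 ≤ N := (abs_nonneg _).trans (hN s ⟨by linarith, le_rfl⟩)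
  rcases le_total t s with hts | hts
  · have := le_mul_of_one_le_left (add_nonneg hN0 hF) (one_le_growthFactor hA hT)
    linarith [hN t ⟨ht.1, hts⟩]
  have hle := norm_le_exp_of_norm_deriv_right_le_history (b := s + T)
    (add_nonneg hA zero_le_one) hF
    (hy.continuousOn.mono fun u hu => by simp only [mem_Ici]; linarith [hu.1])
    (fun u hu => hy.equation u hu.1) (hN s ⟨by linarith, le_rfl⟩) (fun u hu B hB hyB => by
      have hhist (τ : ℝ) (hτ : τ ∈ Icc (u - p) u) : |y τ| ≤ B := by
        rcases le_total τ s with hτs | hτs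
        · exact (hN τ ⟨by linarith [hτ.1, hu.1], hτs⟩).trans hB
        · exact hyB τ ⟨hτs, hτ.2⟩
      obtain ⟨hlow, hup⟩ := S.sub_delay_mem_Icc (hs.trans hu.1)
      have hεB := mul_le_mul_of_nonneg_right hε (hN0.trans hB)
      refine (S.abs_forced_deriv_le (hs.trans hu.1) (hhist _ ⟨by linarith, hup⟩)
        (hf u ⟨hu.1, hu.2.le⟩ B hhist)).trans ?_
      linarith) t ⟨hts, ht.2⟩
  calc |y t| ≤ ((A + 1 + 1) * N + F) * Real.exp ((A + 1 + 1) * (t - s)) := hle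
    _ ≤ ((A + 2) * (N + F)) * Real.exp ((A + 2) * T) := by
        rw [add_assoc A, one_add_one_eq_two]
        have := ht.2
        gcongr
        · nlinarith
        · linarith
    _ = growthFactor A T * (N + F) := by rw [growthFactor]; ring

theorem abs_le_quarter_add (S : IsBoundedDelaySystem a r q A)
    (hE : ExponentialEstimate a r q K σ) (hK : 0 ≤ K) (hqp : q ≤ p) (hs : 0 ≤ s) (hT : 0 ≤ T)
    (hKT : K * Real.exp (-σ * T) ≤ 1 / 8) (hε : 0 ≤ ε) (hεG : ε * growthFactor A T ^ 2 ≤ 1 / 8)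
    (hF : 0 ≤ F) (hy : IsForcedSolution a r f p s y) (hN : ∀ t ∈ Icc (s - p) s, |y t| ≤ N)
    (hf : ∀ t ∈ Icc s (s + T), ∀ N, (∀ u ∈ Icc (t - p) t, |y u| ≤ N) → |f t| ≤ ε * N + F) :
    |y (s + T)| ≤ 1 / 4 * N + 2 * growthFactor A T * F := by
  have hp : 0 ≤ p := S.maxDelay_nonneg.trans hqp
  have hN0 : 0 ≤ N := (abs_nonneg _).trans (hN s ⟨by linarith, le_rfl⟩)
  have hexpG := exp_le_growthFactor S.bound_nonneg hT
  have hG := one_le_growthFactor S.bound_nonneg hT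
  set G := growthFactor A T
  have hε1 : ε ≤ 1 := by
    linarith [le_mul_of_one_le_right hε (one_le_pow₀ hG (n := 2))]
  have hforcing (t : ℝ) (ht : t ∈ Icc s (s + T)) : |f t| ≤ ε * (G * (N + F)) + F :=
    hf t ht _ fun u hu => abs_le_growthFactor_mul S hqp hs hT hε1 hF hy hN hf
      ⟨by linarith [ht.1, hu.1], hu.2.trans ht.2⟩
  have hle := abs_le_of_abs_forcing_le S hE hK hs (by positivity)
    (hy.mono le_rfl (by linarith)) (fun t ht => hN t ⟨by linarith [ht.1], ht.2⟩) hforcing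
    (right_mem_Icc.2 (by linarith : s ≤ s + T))
  rw [add_sub_cancel_left] at hle
  have hfree : K * N * Real.exp (-σ * T) ≤ 1 / 8 * N := by
    linarith [mul_le_mul_of_nonneg_right hKT hN0]
  have hforced : (ε * (G * (N + F)) + F) * Real.exp ((A + 1) * T) ≤ 1 / 8 * (N + F) + G * F :=
    calc (ε * (G * (N + F)) + F) * Real.exp ((A + 1) * T)
        ≤ (ε * (G * (N + F)) + F) * G := by gcongr
      _ = ε * G ^ 2 * (N + F) + G * F := by ring
      _ ≤ 1 / 8 * (N + F) + G * F := by gcongr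
  linarith [le_mul_of_one_le_left hF hG]

theorem abs_le_exp_of_small_forcing (S : IsBoundedDelaySystem a r q A)
    (hE : ExponentialEstimate a r q K σ) (hK : 0 ≤ K) (D : IsDecayScale K σ p T η)
    (hqp : q ≤ p) (hs : 0 ≤ s) (hε : 0 ≤ ε) (hεG : ε * growthFactor A T ^ 2 ≤ 1 / 8) (hF : 0 ≤ F)
    (hy : IsForcedSolution a r f p s y) (hN : ∀ t ∈ Icc (s - p) s, |y t| ≤ N)
    (hf : ∀ t, s ≤ t → ∀ N, (∀ u ∈ Icc (t - p) t, |y u| ≤ N) →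
      |f t| ≤ ε * N + F * Real.exp (-η * (t - s))) {t : ℝ} (ht : s ≤ t) :
    |y t| ≤ 10 * growthFactor A T * (N + F) * Real.exp (-η * (t - s)) := by
  have hp : 0 ≤ p := S.maxDelay_nonneg.trans hqp
  have hT : 0 ≤ T := hp.trans D.history_le
  have hη := D.rate_pos.le
  have hN0 : 0 ≤ N := (abs_nonneg _).trans (hN s ⟨by linarith, le_rfl⟩)
  have hG := one_le_growthFactor S.bound_nonneg hT
  set G := growthFactor A T
  have hε1 : ε ≤ 1 := by
    linarith [le_mul_of_one_le_right hε (one_le_pow₀ hG (n := 2))]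
  have hexpT : Real.exp (η * T) ≤ 2 := le_trans (by gcongr; linarith) D.exp_rate_le
  have hforcing {s' : ℝ} (hs' : s ≤ s') (u : ℝ) (hu : u ∈ Icc s' (s' + T)) (B : ℝ)
      (hB : ∀ τ ∈ Icc (u - p) u, |y τ| ≤ B) : |f u| ≤ ε * B + F * Real.exp (-η * (s' - s)) := by
    refine (hf u (hs'.trans hu.1) B hB).trans ?_
    gcongr ε * B + F * ?_
    exact Real.exp_le_exp.2 (by nlinarith [hu.1])
  have hinit (u : ℝ) (hu : u ∈ Icc (s - p) (s + T)) : |y u| ≤ G * (N + F) := by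
    simpa using abs_le_growthFactor_mul S hqp hs hT hε1 (by positivity) hy hN
      (hforcing le_rfl) hu
  have hstep (u : ℝ) (hu : s + T ≤ u) (B : ℝ)
      (hB : ∀ τ ∈ Icc (u - T - p) (u - T), |y τ| ≤ B) :
      |y u| ≤ 1 / 4 * B + 4 * G * F * Real.exp (-η * (u - s)) := by
    have hsu : s ≤ u - T := by linarith
    have hle := abs_le_quarter_add S hE hK hqp (hs.trans hsu) hT D.mul_exp_le hε hεG (by positivity)
      (hy.mono hsu (by linarith)) hB (hforcing hsu)
    have hshift : Real.exp (-η * (u - T - s)) ≤ 2 * Real.exp (-η * (u - s)) := by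
      rw [sub_right_comm]
      exact D.exp_sub_le (by linarith) _
    rw [sub_add_cancel] at hle
    linarith [mul_le_mul_of_nonneg_left hshift (by positivity : 0 ≤ 2 * G * F)]
  calc |y t| ≤ (Real.exp (η * T) * (G * (N + F)) + 2 * (4 * G * F)) * Real.exp (-η * (t - s)) :=
        le_mul_exp_of_delayed_contraction hp hT hη (by linarith [D.exp_rate_le]) (by positivity)
          (fun u => abs_nonneg (y u)) hy.continuousOn.abs hinit hstep ht
    _ ≤ 10 * G * (N + F) * Real.exp (-η * (t - s)) := by
        gcongr
        have hGN : 0 ≤ G * N := by positivity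
        linarith [mul_le_mul_of_nonneg_right hexpT (by positivity : 0 ≤ G * (N + F))]

end IsForcedSolution

end Perturbation

section Grid

variable {r : ℝ → ℝ} {q h t : ℝ}

theorem gridFloor_le (hh : 0 < h) (t : ℝ) : gridFloor h t ≤ t :=
  (le_div_iff₀ hh).1 (Int.floor_le _)

theorem lt_gridFloor_add (hh : 0 < h) (t : ℝ) : t < gridFloor h t + h := by
  have := (div_lt_iff₀ hh).1 (Int.lt_floor_add_one (t / h))
  rwa [add_mul, one_mul] at this

theorem gridFloor_nonneg (hh : 0 < h) (ht : 0 ≤ t) : 0 ≤ gridFloor h t :=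
  mul_nonneg (Int.cast_nonneg (Int.floor_nonneg.2 (div_nonneg ht hh.le))) hh.le

theorem gridArg_eq (r : ℝ → ℝ) (hh : 0 < h) (t : ℝ) :
    gridArg r h t = ((⌊t / h⌋ - ⌊r (gridFloor h t) / h⌋ : ℤ) : ℝ) * h := by
  rw [gridArg, gridFloor, gridFloor, sub_div, mul_div_cancel_right₀ _ hh.ne',
    Int.floor_sub_intCast]

theorem gridArg_eq_sub (r : ℝ → ℝ) (hh : 0 < h) (t : ℝ) :
    gridArg r h t = gridFloor h t - gridFloor h (r (gridFloor h t)) := by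
  rw [gridArg_eq r hh, Int.cast_sub, sub_mul]
  rfl

theorem neg_le_gridArg (hr : MapsTo r (Ici 0) (Icc 0 q)) (hh : 0 < h) (ht : 0 ≤ t) :
    -q ≤ gridArg r h t := by
  rw [gridArg_eq_sub r hh]
  linarith [gridFloor_nonneg hh ht, gridFloor_le hh (r (gridFloor h t)),
    (hr (gridFloor_nonneg hh ht)).2]

theorem gridArg_mem_Icc (hr : MapsTo r (Ici 0) (Icc 0 q)) (hh : 0 < h) (ht : 0 ≤ t) :
    gridArg r h t ∈ Icc (t - q - h) t := by
  have hrt := hr (gridFloor_nonneg hh ht)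
  rw [gridArg_eq_sub r hh]
  constructor
  · linarith [lt_gridFloor_add hh t, gridFloor_le hh (r (gridFloor h t)), hrt.2]
  · linarith [gridFloor_le hh t, gridFloor_nonneg hh hrt.1]

end Grid

section Modulus

variable {r : ℝ → ℝ} {q : ℝ}

theorem abs_sub_le_modulus (hr : MapsTo r (Ici 0) (Icc 0 q)) {t₁ t₂ l : ℝ} (h₁ : 0 ≤ t₁)
    (h₂ : 0 ≤ t₂) (hl : |t₂ - t₁| ≤ l) : |r t₂ - r t₁| ≤ modulus r l := by
  refine le_csSup ⟨q, ?_⟩ ⟨t₁, t₂, h₁, h₂, hl, rfl⟩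
  rintro _ ⟨u, v, hu, hv, -, rfl⟩
  simpa using abs_sub_le_of_le_of_le (hr hv).1 (hr hv).2 (hr hu).1 (hr hu).2

theorem modulus_nonneg (r : ℝ → ℝ) (l : ℝ) : 0 ≤ modulus r l := by
  refine Real.sSup_nonneg ?_
  rintro _ ⟨u, v, -, -, -, rfl⟩
  exact abs_nonneg _

theorem tendsto_modulus (hr : UniformContinuousOn r (Ici 0)) :
    Tendsto (modulus r) (𝓝[>] 0) (𝓝 0) := by
  rw [Metric.tendsto_nhds]
  intro ε hε
  obtain ⟨δ, hδ, hr⟩ := Metric.uniformContinuousOn_iff.1 hr (ε / 2) (half_pos hε)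
  filter_upwards [Ioo_mem_nhdsGT hδ] with l hl
  rw [Real.dist_eq, sub_zero, abs_of_nonneg (modulus_nonneg r l)]
  refine (Real.sSup_le ?_ (half_pos hε).le).trans_lt (half_lt_self hε)
  rintro _ ⟨u, v, hu, hv, huv, rfl⟩
  exact (hr v hv u hu (huv.trans_lt hl.2)).le

theorem tendsto_errorCoeff (a : ℝ → ℝ) (hr : UniformContinuousOn r (Ici 0)) (K : ℝ) :
    Tendsto (errorCoeff a r K) (𝓝[>] 0) (𝓝 0) := by
  have hid : Tendsto (fun h : ℝ => h) (𝓝[>] 0) (𝓝 0) := tendsto_id.mono_left nhdsWithin_le_nhds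
  have hlim := (((hid.const_mul 2).add (tendsto_modulus hr)).const_mul (supAbs a ^ 2)).mul_const K
  rwa [mul_zero, add_zero, mul_zero, zero_mul] at hlim

theorem exists_forall_errorCoeff_le (a : ℝ → ℝ) (hr : UniformContinuousOn r (Ici 0)) (K : ℝ)
    (hq : 0 < q) {ε : ℝ} (hε : 0 < ε) :
    ∃ h₀ ∈ Ioc 0 q, ∀ h ∈ Ioc 0 h₀, errorCoeff a r K h ≤ ε := by
  obtain ⟨h₁, hh₁, hle⟩ := mem_nhdsGT_iff_exists_Ioc_subset.1
    ((tendsto_errorCoeff a hr K).eventually_le_const hε)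
  exact ⟨min h₁ q, ⟨lt_min hh₁ hq, min_le_right _ _⟩, fun h hh =>
    hle ⟨hh.1, hh.2.trans (min_le_left _ _)⟩⟩

theorem abs_gridArg_sub_le (hr : MapsTo r (Ici 0) (Icc 0 q)) {h t : ℝ} (hh : 0 < h)
    (ht : 0 ≤ t) : |gridArg r h t - (t - r t)| ≤ 2 * h + modulus r h := by
  have htle := gridFloor_le hh t
  have htlt := lt_gridFloor_add hh t
  have hrle := gridFloor_le hh (r (gridFloor h t))
  have hrlt := lt_gridFloor_add hh (r (gridFloor h t))
  have hmod := abs_le.1 (abs_sub_le_modulus hr (gridFloor_nonneg hh ht) ht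
    (l := h) (by rw [abs_le]; constructor <;> linarith))
  rw [gridArg_eq_sub r hh, abs_le]
  constructor <;> linarith [hmod.1, hmod.2]

end Modulus

/-- The forcing with respect to which a solution of the equation with piecewise constant argument
solves the delay equation `x'(t) = -a(t) x(t - r(t))`. -/
noncomputable def delayDefect (a r : ℝ → ℝ) (h : ℝ) (z : ℝ → ℝ) (t : ℝ) : ℝ :=
  -a t * (z (gridArg r h t) - z (t - r t))

namespace IsPiecewiseSolution

variable {a r z : ℝ → ℝ} {q h A : ℝ} {φ : C(Icc (-q) 0, ℝ)}

theorem hasDerivWithinAt (hz : IsPiecewiseSolution a r q h φ z) (hh : 0 < h) {t : ℝ}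
    (ht : 0 ≤ t) : HasDerivWithinAt z (-a t * z (gridArg r h t)) (Ici t) t := by
  have hle : (⌊t / h⌋₊ : ℝ) * h ≤ t := (le_div_iff₀ hh).1 (Nat.floor_le (by positivity))
  have hlt : t < (⌊t / h⌋₊ + 1 : ℝ) * h := (div_lt_iff₀ hh).1 (Nat.lt_floor_add_one _)
  rcases hle.eq_or_lt with heq | hgt
  · simpa only [heq] using hz.equation_right ⌊t / h⌋₊
  · exact (hz.equation _ t ⟨hgt, hlt⟩).hasDerivWithinAt

theorem isForcedSolution (hz : IsPiecewiseSolution a r q h φ z) (hh : 0 < h) {p s : ℝ}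
    (hs : 0 ≤ s) (hp : p ≤ s) : IsForcedSolution a r (delayDefect a r h z) p s z where
  continuousOn := hz.continuousOn.mono (Ici_subset_Ici.2 (sub_nonneg.2 hp))
  equation t ht := (hz.hasDerivWithinAt hh (hs.trans ht)).congr_deriv (by
    rw [delayDefect]
    ring)

theorem abs_intCast_mul_le_norm (hz : IsPiecewiseSolution a r q h φ z) (n : ℤ)
    (hn : (n : ℝ) * h ∈ Icc (-q) 0) : |z (n * h)| ≤ ‖φ‖ := by
  rw [hz.initial n hn]
  exact φ.norm_coe_le_norm _

theorem abs_gridArg_le_norm (hz : IsPiecewiseSolution a r q h φ z)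
    (hr : MapsTo r (Ici 0) (Icc 0 q)) (hh : 0 < h) {t : ℝ} (ht : 0 ≤ t)
    (hneg : gridArg r h t ≤ 0) : |z (gridArg r h t)| ≤ ‖φ‖ := by
  have hge := neg_le_gridArg hr hh ht
  rw [gridArg_eq r hh] at hge hneg ⊢
  exact hz.abs_intCast_mul_le_norm _ ⟨hge, hneg⟩

theorem abs_deriv_le (S : IsBoundedDelaySystem a r q A) {t N : ℝ} (ht : 0 ≤ t)
    (hN : |z (gridArg r h t)| ≤ N) : |-a t * z (gridArg r h t)| ≤ A * N := by
  rw [neg_mul, abs_neg]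
  exact (S.abs_coeff_mul_le ht _).trans (mul_le_mul_of_nonneg_left hN S.bound_nonneg)

theorem abs_sub_le (hz : IsPiecewiseSolution a r q h φ z) (S : IsBoundedDelaySystem a r q A)
    (hh : 0 < h) {c b u v B : ℝ} (hc : 0 ≤ c) (hB : ∀ ξ ∈ Icc c b, |z (gridArg r h ξ)| ≤ B)
    (hu : u ∈ Icc c b) (hv : v ∈ Icc c b) : |z u - z v| ≤ A * B * |u - v| := by
  wlog hvu : v ≤ u generalizing u v
  · rw [abs_sub_comm, abs_sub_comm u]
    exact this hv hu (le_of_not_ge hvu)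
  have hpos (w : ℝ) (hw : w ∈ Icc v u) : 0 ≤ w := hc.trans (hv.1.trans hw.1)
  rw [abs_of_nonneg (sub_nonneg.2 hvu)]
  exact norm_image_sub_le_of_norm_deriv_right_le_segment
    (hz.continuousOn.mono hpos)
    (fun w hw => hz.hasDerivWithinAt hh (hpos w ⟨hw.1, hw.2.le⟩))
    (fun w hw => abs_deriv_le S (hpos w ⟨hw.1, hw.2.le⟩)
      (hB w ⟨hv.1.trans hw.1, hw.2.le.trans hu.2⟩)) u ⟨hvu, le_rfl⟩

theorem abs_delayDefect_le (hz : IsPiecewiseSolution a r q h φ z)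
    (S : IsBoundedDelaySystem a r q A) (hh : 0 < h) (hhq : h ≤ q) {t B : ℝ} (ht : 2 * q ≤ t)
    (hB : ∀ ξ ∈ Icc (t - 2 * q) t, |z (gridArg r h ξ)| ≤ B) :
    |delayDefect a r h z t| ≤ A ^ 2 * (2 * h + modulus r h) * B := by
  have hA := S.bound_nonneg
  have ht0 : 0 ≤ t := by linarith
  have hB0 : 0 ≤ B := (abs_nonneg _).trans (hB t ⟨by linarith, le_rfl⟩)
  have hgrid := gridArg_mem_Icc S.mapsTo_delay hh ht0
  have hdelay := S.sub_delay_mem_Icc ht0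
  have hsub := hz.abs_sub_le S hh (sub_nonneg.2 ht) hB
    (u := gridArg r h t) (v := t - r t) ⟨by linarith [hgrid.1], hgrid.2⟩
    ⟨by linarith [hdelay.1], hdelay.2⟩
  rw [delayDefect, neg_mul, abs_neg]
  calc |a t * (z (gridArg r h t) - z (t - r t))|
      ≤ A * |z (gridArg r h t) - z (t - r t)| := S.abs_coeff_mul_le ht0 _
    _ ≤ A * (A * B * (2 * h + modulus r h)) := by
        gcongr
        exact hsub.trans (by gcongr; exact abs_gridArg_sub_le S.mapsTo_delay hh ht0)
    _ = A ^ 2 * (2 * h + modulus r h) * B := by ring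

theorem abs_le_growthFactor_mul (hz : IsPiecewiseSolution a r q h φ z)
    (S : IsBoundedDelaySystem a r q A) (hh : 0 < h) {t T : ℝ} (ht : t ∈ Icc 0 T) :
    |z t| ≤ growthFactor A T * ‖φ‖ := by
  have hA := S.bound_nonneg
  have hle := norm_le_exp_of_norm_deriv_right_le_history (b := T) (F := 0) hA le_rfl
    (hz.continuousOn.mono fun u hu => hu.1) (fun u hu => hz.hasDerivWithinAt hh hu.1)
    (by simpa using hz.abs_intCast_mul_le_norm 0 (by simpa using S.maxDelay_nonneg))
    (fun u hu N hN hzN => by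
      rw [add_zero]
      refine abs_deriv_le S hu.1 ?_
      rcases le_total (gridArg r h u) 0 with hneg | hpos
      · exact (hz.abs_gridArg_le_norm S.mapsTo_delay hh hu.1 hneg).trans hN
      · exact hzN _ ⟨hpos, (gridArg_mem_Icc S.mapsTo_delay hh hu.1).2⟩) t ht
  calc |z t| ≤ ((A + 1) * ‖φ‖ + 0) * Real.exp ((A + 1) * (t - 0)) := hle
    _ ≤ ((A + 2) * ‖φ‖) * Real.exp ((A + 2) * T) := by
        rw [add_zero, sub_zero]
        have := ht.1
        gcongr
        · norm_num
        · norm_num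
        · exact ht.2
    _ = growthFactor A T * ‖φ‖ := by rw [growthFactor]; ring

section Decay

variable {K σ T η : ℝ}

theorem abs_le_exp (hz : IsPiecewiseSolution a r q h φ z) (S : IsBoundedDelaySystem a r q A)
    (hE : ExponentialEstimate a r q K σ) (hK : 0 ≤ K) (D : IsDecayScale K σ (4 * q) T η)
    (hh : 0 < h) (hhq : h ≤ q)
    (hsmall : A ^ 2 * (2 * h + modulus r h) * growthFactor A T ^ 2 ≤ 1 / 8) {t : ℝ}
    (ht : 0 ≤ t) :
    |z t| ≤ 10 * growthFactor A T ^ 2 * ‖φ‖ * Real.exp (-η * (t - 4 * q)) := by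
  have hinit (u : ℝ) (hu : u ∈ Icc (4 * q - 4 * q) (4 * q)) : |z u| ≤ growthFactor A T * ‖φ‖ :=
    hz.abs_le_growthFactor_mul S hh ⟨by linarith [hu.1], hu.2.trans D.history_le⟩
  have hdefect (u : ℝ) (hu : 4 * q ≤ u) (N : ℝ) (hN : ∀ τ ∈ Icc (u - 4 * q) u, |z τ| ≤ N) :
      |delayDefect a r h z u| ≤
        A ^ 2 * (2 * h + modulus r h) * N + 0 * Real.exp (-η * (u - 4 * q)) := by
    rw [zero_mul, add_zero]
    refine hz.abs_delayDefect_le S hh hhq (by linarith) fun ξ hξ => hN _ ?_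
    have hgrid := gridArg_mem_Icc S.mapsTo_delay hh (by linarith [hξ.1] : 0 ≤ ξ)
    exact ⟨by linarith [hgrid.1, hξ.1], hgrid.2.trans hξ.2⟩
  rcases le_total t (4 * q) with htq | htq
  · have hG := one_le_growthFactor S.bound_nonneg (by linarith [D.history_le] : 0 ≤ T)
    have hexp : 1 ≤ Real.exp (-η * (t - 4 * q)) :=
      Real.one_le_exp (mul_nonneg_of_nonpos_of_nonpos (neg_nonpos.2 D.rate_pos.le)
        (sub_nonpos.2 htq))
    calc |z t| ≤ growthFactor A T * ‖φ‖ := hinit t ⟨by linarith, htq⟩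
      _ ≤ 10 * growthFactor A T ^ 2 * ‖φ‖ := by
          gcongr
          nlinarith
      _ ≤ 10 * growthFactor A T ^ 2 * ‖φ‖ * Real.exp (-η * (t - 4 * q)) :=
          le_mul_of_one_le_right (by positivity) hexp
  · have hw := modulus_nonneg r h
    exact (IsForcedSolution.abs_le_exp_of_small_forcing S hE hK D (by linarith) (by linarith)
      (by positivity) hsmall le_rfl (hz.isForcedSolution hh (by linarith) le_rfl) hinit hdefect
      htq).trans_eq (by ring)

theorem abs_gridArg_le_exp (hz : IsPiecewiseSolution a r q h φ z)
    (S : IsBoundedDelaySystem a r q A) (hE : ExponentialEstimate a r q K σ) (hK : 0 ≤ K)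
    (D : IsDecayScale K σ (4 * q) T η) (hh : 0 < h) (hhq : h ≤ q)
    (hsmall : A ^ 2 * (2 * h + modulus r h) * growthFactor A T ^ 2 ≤ 1 / 8) {t : ℝ}
    (ht : 0 ≤ t) :
    |z (gridArg r h t)| ≤ 10 * growthFactor A T ^ 2 * ‖φ‖ * Real.exp (-η * (t - 6 * q)) := by
  have hG := one_le_growthFactor S.bound_nonneg (by linarith [D.history_le] : 0 ≤ T)
  have hη := D.rate_pos
  have hgrid := gridArg_mem_Icc S.mapsTo_delay hh ht
  rcases le_total (gridArg r h t) 0 with hneg | hpos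
  · have hexp : 1 ≤ Real.exp (-η * (t - 6 * q)) :=
      Real.one_le_exp (mul_nonneg_of_nonpos_of_nonpos (neg_nonpos.2 hη.le) (by linarith [hgrid.1]))
    calc |z (gridArg r h t)| ≤ ‖φ‖ := hz.abs_gridArg_le_norm S.mapsTo_delay hh ht hneg
      _ ≤ 10 * growthFactor A T ^ 2 * ‖φ‖ :=
          le_mul_of_one_le_left (norm_nonneg _) (by nlinarith)
      _ ≤ 10 * growthFactor A T ^ 2 * ‖φ‖ * Real.exp (-η * (t - 6 * q)) :=
          le_mul_of_one_le_right (by positivity) hexp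
  · refine (hz.abs_le_exp S hE hK D hh hhq hsmall hpos).trans ?_
    gcongr _ * ?_
    exact Real.exp_le_exp.2 (by nlinarith [hgrid.1])

theorem abs_delayDefect_le_exp (hz : IsPiecewiseSolution a r q h φ z)
    (S : IsBoundedDelaySystem a r q A) (hE : ExponentialEstimate a r q K σ) (hK : 0 ≤ K)
    (D : IsDecayScale K σ (4 * q) T η) (hh : 0 < h) (hhq : h ≤ q)
    (hsmall : A ^ 2 * (2 * h + modulus r h) * growthFactor A T ^ 2 ≤ 1 / 8) {t : ℝ}
    (ht : 2 * q ≤ t) :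
    |delayDefect a r h z t| ≤
      20 * growthFactor A T ^ 2 * (A ^ 2 * (2 * h + modulus r h)) * ‖φ‖ * Real.exp (-η * t) := by
  have hη := D.rate_pos
  have hgrid (ξ : ℝ) (hξ : ξ ∈ Icc (t - 2 * q) t) : |z (gridArg r h ξ)| ≤
      10 * growthFactor A T ^ 2 * ‖φ‖ * (2 * Real.exp (-η * t)) := by
    refine (hz.abs_gridArg_le_exp S hE hK D hh hhq hsmall (by linarith [hξ.1])).trans ?_
    gcongr _ * ?_
    refine le_trans (Real.exp_le_exp.2 ?_)
      (D.exp_sub_le (c := 8 * q) (by linarith [D.history_le]) t)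
    nlinarith [hξ.1]
  exact (hz.abs_delayDefect_le S hh hhq ht hgrid).trans_eq (by ring)

end Decay

end IsPiecewiseSolution

theorem abs_le_segmentNorm {f : ℝ → ℝ} {q t : ℝ} (hf : ContinuousOn f (Icc (t - q) t)) {u : ℝ}
    (hu : u ∈ Icc (t - q) t) : |f u| ≤ segmentNorm q f t := by
  have hmaps : MapsTo (t + ·) (Icc (-q) 0) (Icc (t - q) t) := fun θ hθ =>
    ⟨by linarith [hθ.1], by linarith [hθ.2]⟩
  have hbdd : BddAbove ((fun θ => |f (t + θ)|) '' Icc (-q) 0) :=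
    isCompact_Icc.bddAbove_image (hf.comp (by fun_prop) hmaps).abs
  refine le_csSup hbdd ⟨u - t, ⟨by linarith [hu.1], by linarith [hu.2]⟩, ?_⟩
  simp only [add_sub_cancel]

theorem segmentNorm_nonneg (q : ℝ) (f : ℝ → ℝ) (t : ℝ) : 0 ≤ segmentNorm q f t :=
  Real.sSup_nonneg (forall_mem_image.2 fun _ _ => abs_nonneg _)

section Error

variable {a r x z : ℝ → ℝ} {q h A K σ T η : ℝ} {φ : C(Icc (-q) 0, ℝ)}

theorem abs_sub_le_segmentNorm_add (hx : IsSolution a r q 0 φ x)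
    (hz : IsPiecewiseSolution a r q h φ z) (S : IsBoundedDelaySystem a r q A)
    (hE : ExponentialEstimate a r q K σ) (hK : 0 ≤ K) (D : IsDecayScale K σ (4 * q) T η)
    (hh : 0 < h) (hhq : h ≤ q)
    (hsmall : A ^ 2 * (2 * h + modulus r h) * growthFactor A T ^ 2 ≤ 1 / 8) {s t : ℝ}
    (hs : 2 * q ≤ s) (ht : s ≤ t) :
    |x t - z t| ≤ 10 * growthFactor A T * (segmentNorm q (fun u => x u - z u) s +
      20 * growthFactor A T ^ 2 * (A ^ 2 * (2 * h + modulus r h)) * ‖φ‖) *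
        Real.exp (-η * (t - s)) := by
  have hs0 : 0 ≤ s := by linarith
  have hw := modulus_nonneg r h
  have hy := (hx.isForcedSolution.mono hs0 (by linarith)).sub
    (hz.isForcedSolution hh hs0 (by linarith : q ≤ s))
  refine IsForcedSolution.abs_le_exp_of_small_forcing S hE hK (D.mono (by linarith)) le_rfl hs0
    le_rfl (by norm_num) (by positivity) hy
    (fun u hu => abs_le_segmentNorm (hy.continuousOn.mono fun v hv => hv.1) hu)
    (fun u hu N _ => ?_) ht
  rw [Pi.sub_apply, Pi.zero_apply, zero_sub, abs_neg, zero_mul, zero_add]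
  refine (hz.abs_delayDefect_le_exp S hE hK D hh hhq hsmall (hs.trans hu)).trans ?_
  gcongr _ * ?_
  exact Real.exp_le_exp.2 (by nlinarith [D.rate_pos])

theorem abs_sub_le_errorCoeff (hx : IsSolution a r q 0 φ x)
    (hz : IsPiecewiseSolution a r q h φ z) (S : IsBoundedDelaySystem a r q (supAbs a))
    (hE : ExponentialEstimate a r q K σ) (hK : 0 ≤ K) (D : IsDecayScale K σ (4 * q) T η)
    (hh : 0 < h) (hhq : h ≤ q)
    (hsmall : errorCoeff a r (growthFactor (supAbs a) T ^ 2) h ≤ 1 / 8) {C : ℝ}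
    (hC : 10 * growthFactor (supAbs a) T ≤ C) {s t : ℝ} (hs : 3 * q ≤ s) (ht : s ≤ t) :
    |x t - z t| ≤ (C * segmentNorm q (fun u => x u - z u) s + errorCoeff a r C h *
      (20 * growthFactor (supAbs a) T ^ 2 / (3 * q)) * ‖φ‖ * t) * Real.exp (-η * (t - s)) := by
  have hq : 0 < q := hh.trans_le hhq
  have hG := one_le_growthFactor S.bound_nonneg (by linarith [D.history_le] : 0 ≤ T)
  set G := growthFactor (supAbs a) T
  have hn := segmentNorm_nonneg q (fun u => x u - z u) s
  have hw := modulus_nonneg r h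
  have hC0 : 0 ≤ C := by linarith
  have hGt : 20 * G ^ 2 ≤ 20 * G ^ 2 / (3 * q) * t := by
    rw [div_mul_eq_mul_div, le_div_iff₀ (by positivity)]
    exact mul_le_mul_of_nonneg_left (hs.trans ht) (by positivity)
  refine (abs_sub_le_segmentNorm_add hx hz S hE hK D hh hhq hsmall (by linarith) ht).trans
    (mul_le_mul_of_nonneg_right ?_ (Real.exp_pos _).le)
  calc 10 * G * (segmentNorm q (fun u => x u - z u) s +
        20 * G ^ 2 * (supAbs a ^ 2 * (2 * h + modulus r h)) * ‖φ‖)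
      ≤ C * (segmentNorm q (fun u => x u - z u) s +
        20 * G ^ 2 * (supAbs a ^ 2 * (2 * h + modulus r h)) * ‖φ‖) := by gcongr
    _ = C * segmentNorm q (fun u => x u - z u) s + errorCoeff a r C h * ‖φ‖ * (20 * G ^ 2) := by
        rw [errorCoeff]
        ring
    _ ≤ C * segmentNorm q (fun u => x u - z u) s +
        errorCoeff a r C h * ‖φ‖ * (20 * G ^ 2 / (3 * q) * t) := by
        have hcoeff : 0 ≤ errorCoeff a r C h := by
          unfold errorCoeff
          positivity
        gcongr
    _ = _ := by ring

end Error

theorem ExponentialEstimate.mono {a r : ℝ → ℝ} {q K K' σ : ℝ} (hE : ExponentialEstimate a r q K σ)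
    (hK : K ≤ K') : ExponentialEstimate a r q K' σ := fun s hs φ x hx t ht =>
  (hE s hs φ x hx t ht).trans (by gcongr)

theorem three_mul_le_startTime (r : ℝ → ℝ) (q : ℝ) : 3 * q ≤ startTime r q :=
  le_add_of_nonneg_right (modulus_nonneg r q)

end DelayEq

theorem theorem4p1_general (a r : ℝ → ℝ) (q : ℝ)
    (ha_cont : ContinuousOn a (Set.Ici 0)) (hr : Set.MapsTo r (Set.Ici 0) (Set.Icc 0 q))
    (hq_pos : 0 < q) (A1 : DelayEq.UniformlyAsymptoticallyStable a r q)
    (A2 : BddAbove ((fun t => |a t|) '' Set.Ici 0))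
    (A3 : UniformContinuousOn r (Set.Ici 0)) :
    ∃ K σ M₁ η h₀ : ℝ, 0 < K ∧ 0 < σ ∧ 0 < M₁ ∧ 0 < η ∧ 0 < h₀ ∧ h₀ ≤ q ∧
      DelayEq.ExponentialEstimate a r q K σ ∧
      (∀ h, 0 < h → h ≤ h₀ → ∀ (φ : C(Set.Icc (-q) 0, ℝ)) (x z : ℝ → ℝ),
        DelayEq.IsSolution a r q 0 φ x → DelayEq.IsPiecewiseSolution a r q h φ z →
        ∀ t, DelayEq.startTime r q ≤ t →
          |x t - z t| ≤
            (K * DelayEq.segmentNorm q (fun s => x s - z s) (DelayEq.startTime r q)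
              + DelayEq.errorCoeff a r K h * M₁ * ‖φ‖ * t)
            * Real.exp (-η * (t - DelayEq.startTime r q))) ∧
      Filter.Tendsto (DelayEq.errorCoeff a r K) (nhdsWithin 0 (Set.Ioi 0)) (nhds 0) := by
  have S : DelayEq.IsBoundedDelaySystem a r q (DelayEq.supAbs a) :=
    ⟨ha_cont, fun t ht => le_csSup A2 ⟨t, ht, rfl⟩, A3.continuousOn, hr⟩
  obtain ⟨K, σ, hK, hσ, hE⟩ := A1.exists_exponentialEstimate hq_pos
  obtain ⟨T, η, D⟩ := DelayEq.exists_isDecayScale K hσ (by positivity : 0 ≤ 4 * q)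
  set G := DelayEq.growthFactor (DelayEq.supAbs a) T
  have hG : 1 ≤ G := DelayEq.one_le_growthFactor S.bound_nonneg (by linarith [D.history_le])
  obtain ⟨h₀, hh₀, hsmall⟩ :=
    DelayEq.exists_forall_errorCoeff_le a A3 (G ^ 2) hq_pos (by norm_num : (0 : ℝ) < 1 / 8)
  refine ⟨K + 10 * G, σ, 20 * G ^ 2 / (3 * q), η, h₀, by positivity, hσ, by positivity,
    D.rate_pos, hh₀.1, hh₀.2, hE.mono (by linarith), fun h hh hhh₀ φ x z hx hz t ht => ?_,
    DelayEq.tendsto_errorCoeff a A3 _⟩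
  exact DelayEq.abs_sub_le_errorCoeff hx hz S hE hK.le D hh (hhh₀.trans hh₀.2)
    (hsmall h ⟨hh, hhh₀⟩) (by linarith) (DelayEq.three_mul_le_startTime r q) ht

theorem theorem4p1 (a r : ℝ → ℝ) (q : ℝ)
    (ha_nonneg : ∀ t, 0 ≤ t → 0 ≤ a t) (ha_cont : ContinuousOn a (Set.Ici 0))
    (hr_nonneg : ∀ t, 0 ≤ t → 0 ≤ r t) (hq : IsLUB (r '' Set.Ici 0) q) (hq_pos : 0 < q)
    (A1 : DelayEq.UniformlyAsymptoticallyStable a r q)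
    (A2 : BddAbove ((fun t => |a t|) '' Set.Ici 0))
    (A3 : UniformContinuousOn r (Set.Ici 0)) :
    ∃ K σ M₁ η h₀ : ℝ, 0 < K ∧ 0 < σ ∧ 0 < M₁ ∧ 0 < η ∧ 0 < h₀ ∧ h₀ ≤ q ∧
      DelayEq.ExponentialEstimate a r q K σ ∧
      (∀ h, 0 < h → h ≤ h₀ → ∀ (φ : C(Set.Icc (-q) 0, ℝ)) (x z : ℝ → ℝ),
        DelayEq.IsSolution a r q 0 φ x → DelayEq.IsPiecewiseSolution a r q h φ z →
        ∀ t, DelayEq.startTime r q ≤ t →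
          |x t - z t| ≤
            (K * DelayEq.segmentNorm q (fun s => x s - z s) (DelayEq.startTime r q)
              + DelayEq.errorCoeff a r K h * M₁ * ‖φ‖ * t)
            * Real.exp (-η * (t - DelayEq.startTime r q))) ∧
      Filter.Tendsto (DelayEq.errorCoeff a r K) (nhdsWithin 0 (Set.Ioi 0)) (nhds 0) :=
  theorem4p1_general a r q ha_cont (fun t ht => ⟨hr_nonneg t ht, hq.1 ⟨t, ht, rfl⟩⟩) hq_pos A1 A2 A3
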